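/- **Conventions.** A graph consists of a set $P$ of points and a set $E$ of edges with source and target maps $s,t:E\to P$. Let $2_{\mathcal G}$ be the graph with points $V,\epsilon$ and exactly three edges $V\to\epsilon$, $\epsilon\to V$, $\epsilon\to\epsilon$. An *open-graph* is a graph $G$ with a morphism $\tau:G\to 2_{\mathcal G}$ such that every edge-point (a point of type $\epsilon$) has at most one in-edge and at most one out-edge; points of type $V$ are called vertices. A *morphism* $f$ of open-graphs is a type-preserving graph morphism that is full on vertices: for each vertex $v$, every edge adjacent to $f(v)$ lies in the image of $f$. A morphism is *mono* if it is left-cancellable with respect to morphisms of open-graphs. An *adhesive pushout* is a commutative square of morphisms of open-graphs that has the universal property of a pushout with respect to morphisms of open-graphs and is also a pushout in the slice category $\mathbf{Graph}/2_{\mathcal G}$. $\mathrm{In}(G)$ (resp. $\mathrm{Out}(G)$) is the set of edge-points of $G$ without in-edges (resp. out-edges). A *boundary map* of $G$ is a map $b:B\to G$, where $B$ has no edges, only edge-points, and its set of points is a disjoint union $B^i\sqcup B^o$ such that $b$ maps $B^i$ bijectively onto $\mathrm{In}(G)$ and $B^o$ bijectively onto $\mathrm{Out}(G)$. A *boundary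 span* $L\xleftarrow{b_1}B\xrightarrow{b_2}R$ is a pair of boundary maps for the same decomposition $B=B^i\sqcup B^o$. A *rewrite rule* $r: L\multimap R$ is a boundary span in which $b_1,b_2$ are mono; its opposite is $R\xleftarrow{b_2}B\xrightarrow{b_1}L$. Let $r$ be a rewrite rule $L\xleftarrow{b_1}B\xrightarrow{b_2}R$ and $m:L\to G$ a mono (a *matching*). Then $r$ *rewrites $G$ to $G'$ at $m$* if there are an open-graph $D$ and morphisms such that $$\begin{array}{ccc}B&\xrightarrow{b_1}&L\\ {\scriptstyle c}\downarrow&&\downarrow{\scriptstyle m}\\ D&\xrightarrow{s}&G\end{array}\qquad\begin{array}{ccc}B&\xrightarrow{b_2}&R\\ {\scriptstyle c}\downarrow&&\downarrow\\ D&\xrightarrow{s'}&G'\end{array}$$ are adhesive pushouts. The *extension* of $r$ by $m$ is the boundary span $G\xleftarrow{b_1'}B'\xrightarrow{b_2'}G'$ for which there is $k:B'\to D$ with $b_1'=sk$ and $b_2'=s'k$. It is a rewrite rule when $b_1',b_2'$ are mono, i.e. when $G$ and $G'$ have no isolated points (points that are both inputs and outputs). A span of monos $H_1\xleftarrow{k_1}K\xrightarrow{k_2}H_2$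 is *boundary coherent* if for each $p\in\mathrm{In}(K)$ at least one of $k_1(p),k_2(p)$ is an input, and for each $p\in\mathrm{Out}(K)$ at least one of $k_1(p),k_2(p)$ is an output. Its adhesive pushout $M$ is the *merging* of $H_1$ and $H_2$ by $k_1,k_2$. Given rewrite rules $r_1:L_1\multimap R_1$ and $r_2:L_2\multimap R_2$ and a boundary-coherent span $R_1\xleftarrow{k_1}K\xrightarrow{k_2}L_2$ with merging $M$, the *sequential composition* $r_1;_{k_1,k_2}r_2$ is the rewrite rule $G\xleftarrow{b_1}B\xrightarrow{b_2}G'$ (unique up to isomorphism), where the opposite of $r_1$ rewrites $M$ to $G$ at the embedding $R_1\to M$ with extension $M\xleftarrow{b}B\xrightarrow{b_1}G$, and $r_2$ rewrites $M$ to $G'$ at the embedding $L_2\to M$ with extension $M\xleftarrow{b}B\xrightarrow{b_2}G'$, for one and the same boundary map $b$ of $M$. **Theorem (Completeness).** Let $r_1:L_1\multimap R_1$ and $r_2:L_2\multimap R_2$ be rewrite rules, and let $M_1,M_2,M_3$ be open-graphs such that $r_1$ rewrites $M_1$ to $M_2$ at a matching $m_1$ and $r_2$ rewrites $M_2$ to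 $M_3$ at a matching $m_2$. Then there are a boundary-coherent span $R_1\xleftarrow{k_1}K\xrightarrow{k_2}L_2$ for which the sequential composition $r_1;_{k_1,k_2}r_2$ exists, and a matching $m'$ of its left-hand side in $M_1$, such that $r_1;_{k_1,k_2}r_2$ rewrites $M_1$ to $M_3$ at $m'$, with an extension $M_1\leftarrow C\to M_3$. If the extensions of $r_1$ by $m_1$ and of $r_2$ by $m_2$ are rewrite rules, then so is this extension. -/

import Mathlib

open CategoryTheory CategoryTheory.Limits

universe u

namespace OpenGraph

/-! ### Directed graphs -/

/-- Directed graphs as functors from `E ⇉ P` to sets: in Mathlib's walking parallel pair the object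
`zero` plays the role of `E` (edges), `one` the role of `P` (points), and the arrows `left`, `right`
are the source and target maps. Morphisms are natural transformations. -/
abbrev Graph : Type (u + 1) := WalkingParallelPair ⥤ Type u

/-- The points of a graph. -/
abbrev Graph.Point (G : Graph.{u}) : Type u := G.obj WalkingParallelPair.one

/-- The edges of a graph. -/
abbrev Graph.Edge (G : Graph.{u}) : Type u := G.obj WalkingParallelPair.zero

/-- The source of an edge. -/
abbrev Graph.src (G : Graph.{u}) (e : Graph.Edge G) : Graph.Point G :=
  G.map WalkingParallelPairHom.left e

/-- The target of an edge. -/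
abbrev Graph.tgt (G : Graph.{u}) (e : Graph.Edge G) : Graph.Point G :=
  G.map WalkingParallelPairHom.right e

/-- The points of the type graph: `V` (vertices) and `eps` (edge-points). -/
inductive TypePoint : Type u
  | V
  | eps

/-- The edges of the type graph: one `V → eps`, one `eps → V` and one loop on `eps`; there is no
loop on `V`. -/
inductive TypeEdge : Type u
  | vToEps
  | epsToV
  | epsLoop

/-- Sources in the type graph. -/
def TypeEdge.src : TypeEdge.{u} → TypePoint.{u}
  | vToEps => .V
  | epsToV => .eps
  | epsLoop => .eps

/-- Targets in the type graph. -/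
def TypeEdge.tgt : TypeEdge.{u} → TypePoint.{u}
  | vToEps => .eps
  | epsToV => .V
  | epsLoop => .eps

/-- The type graph with a vertex type `V` and an edge-point type `eps`. -/
def typeGraph : Graph.{u} :=
  parallelPair (TypeCat.ofHom TypeEdge.src.{u}) (TypeCat.ofHom TypeEdge.tgt.{u})

/-- Typed graphs: the slice category of graphs over the type graph. -/
abbrev TypedGraph : Type (u + 1) := Over typeGraph.{u}

namespace TypedGraph

/-- The points of a typed graph. -/
abbrev Point (G : TypedGraph.{u}) : Type u := Graph.Point G.left

/-- The edges of a typed graph. -/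
abbrev Edge (G : TypedGraph.{u}) : Type u := Graph.Edge G.left

/-- The source of an edge. -/
abbrev src (G : TypedGraph.{u}) (e : Edge G) : Point G := Graph.src G.left e

/-- The target of an edge. -/
abbrev tgt (G : TypedGraph.{u}) (e : Edge G) : Point G := Graph.tgt G.left e

/-- The type of a point. -/
def type (G : TypedGraph.{u}) (p : Point G) : TypePoint.{u} :=
  G.hom.app WalkingParallelPair.one p

/-- `p` is a vertex. -/
def IsVertex (G : TypedGraph.{u}) (p : Point G) : Prop := type G p = TypePoint.V

/-- `p` is an edge-point. -/
def IsEdgePoint (G : TypedGraph.{u}) (p : Point G) : Prop := type G p = TypePoint.eps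

/-- The action of a morphism on points. -/
abbrev onPoint {G H : TypedGraph.{u}} (f : G ⟶ H) (p : Point G) : Point H :=
  f.left.app WalkingParallelPair.one p

/-- The action of a morphism on edges. -/
abbrev onEdge {G H : TypedGraph.{u}} (f : G ⟶ H) (e : Edge G) : Edge H :=
  f.left.app WalkingParallelPair.zero e

/-- A morphism is full on vertices if every edge adjacent to the image of a vertex lies in the
image of the morphism. -/
def FullOnVertices {G H : TypedGraph.{u}} (f : G ⟶ H) : Prop :=
  ∀ v : Point G, IsVertex G v → ∀ e : Edge H,
    (src H e = onPoint f v ∨ tgt H e = onPoint f v) → ∃ e' : Edge G, onEdge f e' = e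

/-- Each edge-point has at most one in-edge and at most one out-edge. -/
def IsOpen (G : TypedGraph.{u}) : Prop :=
  ∀ p : Point G, IsEdgePoint G p → ∀ e e' : Edge G,
    (tgt G e = p → tgt G e' = p → e = e') ∧ (src G e = p → src G e' = p → e = e')

end TypedGraph

/-! ### Open-graphs -/

/-- An open-graph: a typed graph in which every edge-point has at most one in-edge and at most one
out-edge. -/
structure OGraph : Type (u + 1) where
  /-- The underlying typed graph. -/
  typed : TypedGraph.{u}
  isOpen : TypedGraph.IsOpen typed

/-- A morphism of open-graphs: a morphism of typed graphs that is full on vertices. Equations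
between composites are stated in the slice category. -/
@[ext]
structure OHom (G H : OGraph.{u}) : Type u where
  /-- The underlying morphism of typed graphs. -/
  hom : G.typed ⟶ H.typed
  full : TypedGraph.FullOnVertices hom

namespace OGraph

/-- The points of an open-graph. -/
abbrev Point (G : OGraph.{u}) : Type u := TypedGraph.Point G.typed

/-- The edges of an open-graph. -/
abbrev Edge (G : OGraph.{u}) : Type u := TypedGraph.Edge G.typed

/-- The inputs: edge-points without in-edges. -/
def inputs (G : OGraph.{u}) : Set G.Point :=
  {p | TypedGraph.IsEdgePoint G.typed p ∧ ∀ e : G.Edge, TypedGraph.tgt G.typed e ≠ p}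

/-- The outputs: edge-points without out-edges. -/
def outputs (G : OGraph.{u}) : Set G.Point :=
  {p | TypedGraph.IsEdgePoint G.typed p ∧ ∀ e : G.Edge, TypedGraph.src G.typed e ≠ p}

/-- A point-graph consists of isolated points only: every point is both an input and an output. -/
def IsPointGraph (G : OGraph.{u}) : Prop := ∀ p : G.Point, p ∈ G.inputs ∧ p ∈ G.outputs

end OGraph

namespace OHom

/-- The action of an open-graph morphism on points. -/
abbrev onPoint {G H : OGraph.{u}} (f : OHom G H) (p : G.Point) : H.Point :=
  TypedGraph.onPoint f.hom p

/-- Monomorphisms of open-graphs: left-cancellable with respect to open-graph morphisms. -/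
def IsMono {G H : OGraph.{u}} (f : OHom G H) : Prop :=
  ∀ (X : OGraph.{u}) (g h : OHom X G), g.hom ≫ f.hom = h.hom ≫ f.hom → g = h

end OHom

/-- An adhesive pushout: a commutative square of open-graph morphisms that is a pushout among
open-graphs and whose image in the slice category of typed graphs is a pushout as well. -/
structure IsAdhesivePushout {A B C D : OGraph.{u}} (f : OHom A B) (g : OHom A C)
    (i : OHom B D) (j : OHom C D) : Prop where
  universal : ∀ (X : OGraph.{u}) (p : OHom B X) (q : OHom C X),
    f.hom ≫ p.hom = g.hom ≫ q.hom →
      ∃! v : OHom D X, i.hom ≫ v.hom = p.hom ∧ j.hom ≫ v.hom = q.hom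
  slice : IsPushout f.hom g.hom i.hom j.hom

/-! ### Boundaries and rewrite rules -/

/-- `b : B ⟶ G` presents `B` as the coproduct `In(G) + Out(G)` with its canonical map to `G`:
`B` is a point-graph, the points in `ins` form the summand `In(G)`, and the remaining points the
summand `Out(G)`. -/
structure IsBoundaryMap {B G : OGraph.{u}} (b : OHom B G) (ins : Set B.Point) : Prop where
  pointGraph : B.IsPointGraph
  bij_inputs : Set.BijOn b.onPoint ins G.inputs
  bij_outputs : Set.BijOn b.onPoint insᶜ G.outputs

/-- A span `L ⟵ B ⟶ R` by which `L` and `R` share the same boundary `B`: both legs are boundary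
maps, for one and the same splitting of `B` into inputs and outputs. -/
structure BoundarySpan (L B R : OGraph.{u}) : Type u where
  /-- The boundary map of the left-hand side. -/
  left : OHom B L
  /-- The boundary map of the right-hand side. -/
  right : OHom B R
  /-- The points of `B` that stand for inputs. -/
  ins : Set B.Point
  isBoundary_left : IsBoundaryMap left ins
  isBoundary_right : IsBoundaryMap right ins

/-- A boundary span is a rewrite rule when both legs are monomorphisms. -/
def BoundarySpan.IsRule {L B R : OGraph.{u}} (e : BoundarySpan L B R) : Prop :=
  e.left.IsMono ∧ e.right.IsMono

/-- A rewrite rule `L ⊸ R` with boundary `B`. -/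
structure RewriteRule (L B R : OGraph.{u}) : Type u extends BoundarySpan L B R where
  isRule : toBoundarySpan.IsRule

/-- The opposite rewrite rule `R ⊸ L`. -/
def RewriteRule.op {L B R : OGraph.{u}} (r : RewriteRule L B R) : RewriteRule R B L where
  left := r.right
  right := r.left
  ins := r.ins
  isBoundary_left := r.isBoundary_right
  isBoundary_right := r.isBoundary_left
  isRule := ⟨r.isRule.2, r.isRule.1⟩

/-- `r` rewrites `G` to `G'` at the matching `m : L ⟶ G`, and the boundary span `e` between `G`
and `G'` is the extension of `r` by `m`. That is, `m` is mono, and there are a graph `D` (the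
subtraction of `L` from `G`) and a double pushout
```
  L ⟵ B ⟶ R
  m↓    c↓    ↓n
  G ⟵ D ⟶ G'
     s     s'
```
of adhesive pushouts, such that `e.left` and `e.right` factor through `s` and `s'` by one and the
same map `k : B' ⟶ D`. -/
def IsExtension {L B R G B' G' : OGraph.{u}} (r : RewriteRule L B R) (m : OHom L G)
    (e : BoundarySpan G B' G') : Prop :=
  m.IsMono ∧
  ∃ (D : OGraph.{u}) (c : OHom B D) (s : OHom D G) (n : OHom R G') (s' : OHom D G'),
    IsAdhesivePushout r.left c m s ∧
    IsAdhesivePushout r.right c n s' ∧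
    ∃ k : OHom B' D, k.hom ≫ s.hom = e.left.hom ∧ k.hom ≫ s'.hom = e.right.hom

/-! ### Merging and sequential composition -/

/-- A span `H₁ ⟵ K ⟶ H₂` of monomorphisms is boundary coherent if every input of `K` stays an
input under at least one leg and every output of `K` stays an output under at least one leg. -/
structure IsBoundaryCoherent {K H₁ H₂ : OGraph.{u}} (f : OHom K H₁) (g : OHom K H₂) : Prop where
  mono_left : f.IsMono
  mono_right : g.IsMono
  inputs : ∀ p ∈ K.inputs, f.onPoint p ∈ H₁.inputs ∨ g.onPoint p ∈ H₂.inputs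
  outputs : ∀ p ∈ K.outputs, f.onPoint p ∈ H₁.outputs ∨ g.onPoint p ∈ H₂.outputs

/-- `M`, with the embeddings `i₁`, `i₂`, is the merging of `G₁` and `G₂` on `K` by the
boundary-coherent span `k₁`, `k₂`. -/
def IsMerging {K G₁ G₂ M : OGraph.{u}} (k₁ : OHom K G₁) (k₂ : OHom K G₂)
    (i₁ : OHom G₁ M) (i₂ : OHom G₂ M) : Prop :=
  IsBoundaryCoherent k₁ k₂ ∧ IsAdhesivePushout k₁ k₂ i₁ i₂

/-- The rule `q : G ⊸ G'` is the sequential composition of `r₁ : L₁ ⊸ R₁` and `r₂ : L₂ ⊸ R₂` at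
`k₁ : K ⟶ R₁`, `k₂ : K ⟶ L₂`: for the merging `M` of `R₁` and `L₂`, the graph `G` arises from `M`
by the opposite of `r₁` at the embedding of `R₁`, the graph `G'` arises from `M` by `r₂` at the
embedding of `L₂`, and the boundary maps of `q` are those of the two extensions `e₁`, `e₂`, which
share the boundary map of `M`. -/
def IsSeqComp {L₁ B₁ R₁ L₂ B₂ R₂ K G B G' : OGraph.{u}}
    (r₁ : RewriteRule L₁ B₁ R₁) (r₂ : RewriteRule L₂ B₂ R₂)
    (k₁ : OHom K R₁) (k₂ : OHom K L₂) (q : RewriteRule G B G') : Prop :=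
  ∃ (M : OGraph.{u}) (i₁ : OHom R₁ M) (i₂ : OHom L₂ M)
    (e₁ : BoundarySpan M B G) (e₂ : BoundarySpan M B G'),
    IsMerging k₁ k₂ i₁ i₂ ∧
    IsExtension r₁.op i₁ e₁ ∧ IsExtension r₂ i₂ e₂ ∧
    e₁.left = e₂.left ∧ e₁.ins = e₂.ins ∧
    q.left = e₁.right ∧ q.right = e₂.right ∧ q.ins = e₁.ins

end OpenGraph

/-!
Everything happens around `M₂`, which contains the right-hand side `R₁` of the first rule and the
left-hand side `L₂` of the second. Let `M = R₁ ∪ L₂` be their union, `B` its boundary and `E` the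
part of `M₂` outside `M`, so that `M₂ = M ∪_B E`. As `M` contains `R₁` and `L₂`, both rewrites of
`M₂` restrict to `M` and leave `E` alone: the van Kampen property of pushouts along
monomorphisms cuts the double pushouts down to `M`. If the opposite of `r₁` turns `M` into `G`
and `r₂` turns `M` into `G'`, then pasting pushouts gives `M₁ = G ∪_B E` and `M₃ = G' ∪_B E`, and
this is a double pushout for the composite rule `G ⟵ B ⟶ G'`.
-/

namespace OpenGraph

section Adhesive

variable {𝒞 : Type*} [Category* 𝒞] [Adhesive 𝒞] {A B C D M N : 𝒞} {f : A ⟶ B} {g : A ⟶ C}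
  {i : B ⟶ D} {j : C ⟶ D}

/- The square is the top face of a cube over the given pushout, whose vertical faces are
pullbacks. -/
theorem isPushout_of_isPullback_of_mono (h : IsPushout f g i j) [Mono f] {k : M ⟶ D} [Mono k]
    {i' : B ⟶ M} (hi : i' ≫ k = i) {j' : N ⟶ M} {l : N ⟶ C} (hN : IsPullback j' l k j)
    {g' : A ⟶ N} (hg : g' ≫ l = g) : IsPushout f g' i' j' := by
  have : Mono l := hN.mono_snd_of_mono
  have comm : f ≫ i' = g' ≫ j' := by
    rw [← cancel_mono k, Category.assoc, Category.assoc, hi, hN.w, reassoc_of% hg, h.w]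
  exact (Adhesive.van_kampen h f g' i' j' (𝟙 A) (𝟙 B) l k .of_id_snd
    (.of_vert_isIso_mono ⟨by simpa⟩) ⟨by simpa⟩ ⟨hN.w⟩ ⟨comm⟩).2
    ⟨.of_vert_isIso_mono ⟨by simpa⟩, hN⟩

theorem mono_of_isPullback_of_isPushout (h : IsPullback f g i j) [Mono i] [Mono j] {i' : B ⟶ M}
    {j' : C ⟶ M} (h' : IsPushout f g i' j') {k : M ⟶ D} (hi : i' ≫ k = i) (hj : j' ≫ k = j) :
    Mono k := by
  have hpushout : IsPushout (pullback.fst i j) (pullback.snd i j) i' j' :=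
    h'.of_iso h.isoPullback (.refl B) (.refl C) (.refl M) (by simp) (by simp) (by simp) (by simp)
  have hk : k = hpushout.isoPushout.hom ≫ pushout.desc i j pullback.condition := by
    apply hpushout.hom_ext
    · simpa [hi] using (pushout.inl_desc i j pullback.condition).symm
    · simpa [hj] using (pushout.inr_desc i j pullback.condition).symm
  rw [hk]
  infer_instance

end Adhesive

theorem bijOn_comp_iff_of_injective {α β γ : Type*} {f : α → β} {g : β → γ} {s : Set α} {t : Set γ}
    (hg : Function.Injective g) (ht : t ⊆ Set.range g) :
    Set.BijOn (g ∘ f) s t ↔ Set.BijOn f s (g ⁻¹' t) := by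
  have himage : g '' (g ⁻¹' t) = t := Set.image_preimage_eq_of_subset ht
  constructor
  · intro h
    refine ⟨h.mapsTo, h.injOn.of_comp, fun y hy => ?_⟩
    obtain ⟨x, hx, hxy⟩ := h.surjOn hy
    exact ⟨x, hx, hg hxy⟩
  · intro h
    exact himage ▸ hg.injOn.bijOn_image.comp h

namespace TypedGraph

variable {G H K X : TypedGraph.{u}}

/-- The end of the edge `e` selected by `φ`: its source for `φ = left`, its target for
`φ = right`. It lets statements about in-edges and out-edges be proved at once. -/
abbrev endpoint (G : TypedGraph.{u}) (φ : WalkingParallelPair.zero ⟶ WalkingParallelPair.one)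
    (e : Edge G) : Point G :=
  G.left.map φ e

variable {φ : WalkingParallelPair.zero ⟶ WalkingParallelPair.one}

theorem onPoint_endpoint (f : G ⟶ H) (e : Edge G) :
    onPoint f (endpoint G φ e) = endpoint H φ (onEdge f e) :=
  NatTrans.naturality_apply f.left φ e

theorem type_onPoint (f : G ⟶ H) (p : Point G) : type H (onPoint f p) = type G p :=
  congrArg (fun t => t.app WalkingParallelPair.one p) (Over.w f)

theorem isVertex_onPoint_iff (f : G ⟶ H) {p : Point G} :
    IsVertex H (onPoint f p) ↔ IsVertex G p := by
  rw [IsVertex, type_onPoint, IsVertex]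

theorem isEdgePoint_onPoint_iff (f : G ⟶ H) {p : Point G} :
    IsEdgePoint H (onPoint f p) ↔ IsEdgePoint G p := by
  rw [IsEdgePoint, type_onPoint, IsEdgePoint]

theorem isVertex_or_isEdgePoint (p : Point G) : IsVertex G p ∨ IsEdgePoint G p := by
  unfold IsVertex IsEdgePoint
  cases type G p <;> simp

theorem IsEdgePoint.not_isVertex {p : Point G} (hp : IsEdgePoint G p) : ¬ IsVertex G p :=
  fun hv => TypePoint.noConfusion (hp.symm.trans hv)

theorem hom_ext_app {f g : G ⟶ H} (h : ∀ Z x, f.left.app Z x = g.left.app Z x) : f = g := by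
  apply Over.OverMorphism.ext
  ext Z x
  exact h Z x

theorem app_comm {f : X ⟶ G} {g : X ⟶ H} {i : G ⟶ K} {j : H ⟶ K} (h : f ≫ i = g ≫ j)
    {Z : WalkingParallelPair} (x : X.left.obj Z) :
    i.left.app Z (f.left.app Z x) = j.left.app Z (g.left.app Z x) :=
  congrArg (fun t : X ⟶ K => t.left.app Z x) h

theorem mono_iff_injective_app {f : G ⟶ H} :
    Mono f ↔ ∀ Z, Function.Injective (f.left.app Z) := by
  rw [← (Over.forget typeGraph).mono_map_iff_mono, NatTrans.mono_iff_mono_app]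
  exact forall_congr' fun Z => mono_iff_injective _

theorem injective_app (f : G ⟶ H) [hf : Mono f] (Z : WalkingParallelPair) :
    Function.Injective (f.left.app Z) :=
  mono_iff_injective_app.1 hf Z

section Square

variable {A B C D : TypedGraph.{u}} {f : A ⟶ B} {g : A ⟶ C} {i : B ⟶ D} {j : C ⟶ D}

theorem exists_of_isPullback (h : IsPullback f g i j) {Z : WalkingParallelPair}
    {x : B.left.obj Z} {y : C.left.obj Z} (hxy : i.left.app Z x = j.left.app Z y) :
    ∃ a, f.left.app Z a = x ∧ g.left.app Z a = y :=
  Types.exists_of_isPullback ((h.map (Over.forget typeGraph)).app Z) x y hxy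

theorem mem_range_or_mem_range_of_isPushout (h : IsPushout f g i j) {Z : WalkingParallelPair}
    (z : D.left.obj Z) : z ∈ Set.range (i.left.app Z) ∨ z ∈ Set.range (j.left.app Z) :=
  Types.eq_or_eq_of_isPushout ((h.map (Over.forget typeGraph)).app Z) z

theorem isPullback_of_forall_mem_range (w : f ≫ i = g ≫ j) [Mono f] [Mono j]
    (h : ∀ Z x, i.left.app Z x ∈ Set.range (j.left.app Z) → x ∈ Set.range (f.left.app Z)) :
    IsPullback f g i j := by
  apply IsPullback.of_map (Over.forget typeGraph.{u}) w
  apply IsPullback.of_forall_isPullback_app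
  refine fun Z => (Types.isPullback_iff _ _ _ _).2 ⟨?_, ?_, ?_⟩
  · ext x
    exact app_comm w x
  · exact fun x y hxy => injective_app f Z hxy.1
  · rintro x y hxy
    obtain ⟨a, rfl⟩ := h Z x ⟨y, hxy.symm⟩
    exact ⟨a, rfl, injective_app j Z ((app_comm w a).symm.trans hxy)⟩

theorem isPushout_of_isPullback_of_cover (h : IsPullback f g i j) [Mono i] [Mono j]
    (hcover : ∀ Z z, z ∈ Set.range (i.left.app Z) ∨ z ∈ Set.range (j.left.app Z)) :
    IsPushout f g i j := by
  apply IsPushout.of_map (Over.forget typeGraph) h.w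
  apply IsPushout.of_forall_isPushout_app
  intro Z
  have : Mono (i.left.app Z) := (mono_iff_injective _).2 (injective_app i Z)
  exact Types.isPushout_of_isPullback_of_mono' ((h.map (Over.forget typeGraph)).app Z)
    (Set.eq_univ_of_forall (hcover Z)) fun x y _ _ hxy => injective_app j Z hxy

end Square

theorem exists_lift_of_forall_mem_range (f : X ⟶ H) (i : G ⟶ H) [Mono i]
    (h : ∀ Z x, f.left.app Z x ∈ Set.range (i.left.app Z)) : ∃ g : X ⟶ G, g ≫ i = f := by
  have : Epi (pullback.fst f i) := by
    apply (Over.forget typeGraph.{u}).epi_of_epi_map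
    rw [NatTrans.epi_iff_epi_app]
    refine fun Z => (epi_iff_surjective _).2 fun x => ?_
    obtain ⟨y, hy⟩ := h Z x
    obtain ⟨z, hz, -⟩ := exists_of_isPullback (.of_hasPullback f i) hy.symm
    exact ⟨z, hz⟩
  have : IsIso (pullback.fst f i) := isIso_of_mono_of_epi _
  exact ⟨inv (pullback.fst f i) ≫ pullback.snd f i, by simp [← pullback.condition]⟩

theorem fullOnVertices_iff {f : G ⟶ H} :
    FullOnVertices f ↔ ∀ (φ : WalkingParallelPair.zero ⟶ WalkingParallelPair.one) (v : Point G),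
      IsVertex G v → ∀ e, endpoint H φ e = onPoint f v → ∃ e', onEdge f e' = e :=
  ⟨fun h φ v hv e he => h v hv e <| match φ with
      | .left => Or.inl he
      | .right => Or.inr he,
    fun h v hv e he => he.elim (h .left v hv e) (h .right v hv e)⟩

theorem isOpen_iff : IsOpen G ↔
    ∀ (φ : WalkingParallelPair.zero ⟶ WalkingParallelPair.one) (e e' : Edge G),
      IsEdgePoint G (endpoint G φ e) → endpoint G φ e' = endpoint G φ e → e' = e := by
  constructor
  · rintro h (_ | _) e e' he hee'
    · exact (h _ he e' e).2 hee' rfl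
    · exact (h _ he e' e).1 hee' rfl
  · rintro h _ hp e e'
    exact ⟨by rintro he rfl; exact h .right e' e hp he, by rintro he rfl; exact h .left e' e hp he⟩

theorem IsOpen.of_mono (hH : IsOpen H) (f : G ⟶ H) [Mono f] : IsOpen G := by
  rw [isOpen_iff] at hH ⊢
  intro φ e e' he hee'
  apply injective_app f
  apply hH φ
  · rwa [← onPoint_endpoint, isEdgePoint_onPoint_iff]
  · rw [← onPoint_endpoint, ← onPoint_endpoint, hee']

theorem FullOnVertices.comp {f : G ⟶ H} (hf : FullOnVertices f) {g : H ⟶ K}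
    (hg : FullOnVertices g) [Mono g] : FullOnVertices (f ≫ g) := by
  rw [fullOnVertices_iff] at hf hg ⊢
  intro φ v hv e he
  obtain ⟨e', rfl⟩ := hg φ _ ((isVertex_onPoint_iff f).2 hv) e he
  obtain ⟨e'', rfl⟩ := hf φ v hv e' (injective_app g _ ((onPoint_endpoint g e').trans he))
  exact ⟨e'', rfl⟩

theorem FullOnVertices.of_comp {f : G ⟶ H} {g : H ⟶ K} [Mono g]
    (h : FullOnVertices (f ≫ g)) : FullOnVertices f := by
  rw [fullOnVertices_iff] at h ⊢
  intro φ v hv e he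
  obtain ⟨e', he'⟩ := h φ v hv (onEdge g e) (by rw [← onPoint_endpoint, he]; rfl)
  exact ⟨e', injective_app g _ he'⟩

theorem FullOnVertices.of_isPullback {f : X ⟶ G} {g : X ⟶ H} {i : G ⟶ K} {j : H ⟶ K}
    (h : IsPullback f g i j) (hi : FullOnVertices i) : FullOnVertices g := by
  rw [fullOnVertices_iff] at hi ⊢
  intro φ v hv e he
  obtain ⟨e', he'⟩ := hi φ (onPoint f v) ((isVertex_onPoint_iff f).2 hv) (onEdge j e) <| by
    rw [← onPoint_endpoint, he]
    exact (app_comm h.w v).symm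
  obtain ⟨a, -, ha⟩ := exists_of_isPullback h he'
  exact ⟨a, ha⟩

theorem FullOnVertices.of_comp_of_isPushout {f : X ⟶ G} {g : X ⟶ H} {i : G ⟶ K} {j : H ⟶ K}
    (h : IsPushout f g i j) {Y : TypedGraph.{u}} {w : K ⟶ Y} (hi : FullOnVertices (i ≫ w))
    (hj : FullOnVertices (j ≫ w)) : FullOnVertices w := by
  rw [fullOnVertices_iff] at hi hj ⊢
  intro φ v hv e he
  obtain ⟨x, rfl⟩ | ⟨x, rfl⟩ := mem_range_or_mem_range_of_isPushout h v
  · obtain ⟨e', rfl⟩ := hi φ x ((isVertex_onPoint_iff i).1 hv) e he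
    exact ⟨_, rfl⟩
  · obtain ⟨e', rfl⟩ := hj φ x ((isVertex_onPoint_iff j).1 hv) e he
    exact ⟨_, rfl⟩

/-- The edge-points that are not the `φ`-end of any edge: the outputs for `φ = left`, the inputs
for `φ = right`. -/
def free (G : TypedGraph.{u}) (φ : WalkingParallelPair.zero ⟶ WalkingParallelPair.one) :
    Set (Point G) :=
  {p | IsEdgePoint G p ∧ ∀ e, endpoint G φ e ≠ p}

theorem mem_free_of_onPoint_mem_free (f : G ⟶ H) {p : Point G} (h : onPoint f p ∈ free H φ) :
    p ∈ free G φ :=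
  ⟨(isEdgePoint_onPoint_iff f).1 h.1, fun e he => h.2 (onEdge f e) <| by
    rw [← onPoint_endpoint, he]⟩

theorem mem_free_of_endpoint_eq_onPoint (hH : IsOpen H) {f : G ⟶ H} (hf : FullOnVertices f)
    {p : Point G} {e : Edge H} (he : endpoint H φ e = onPoint f p)
    (he' : e ∉ Set.range (onEdge f)) : p ∈ free G φ := by
  have hp : IsEdgePoint G p := (isVertex_or_isEdgePoint p).resolve_left fun hv =>
    he' (fullOnVertices_iff.1 hf φ p hv e he)
  refine ⟨hp, fun e₀ he₀ => he' ⟨e₀, isOpen_iff.1 hH φ _ _ ?_ ?_⟩⟩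
  · rwa [he, isEdgePoint_onPoint_iff]
  · rw [← onPoint_endpoint, he₀, he]

end TypedGraph

open TypedGraph

namespace OHom

variable {G H K X : OGraph.{u}}

theorem isMono_of_mono (f : OHom G H) [Mono f.hom] : f.IsMono :=
  fun _ _ _ h => OHom.ext ((cancel_mono f.hom).1 h)

theorem exists_lift (f : OHom X H) (i : OHom G H) [Mono i.hom]
    (h : ∀ Z x, f.hom.left.app Z x ∈ Set.range (i.hom.left.app Z)) :
    ∃ g : OHom X G, g.hom ≫ i.hom = f.hom := by
  obtain ⟨g, hg⟩ := exists_lift_of_forall_mem_range f.hom i.hom h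
  exact ⟨⟨g, .of_comp (hg ▸ f.full)⟩, hg⟩

theorem exists_isPullback (f : OHom G K) (g : OHom H K) [Mono f.hom] :
    ∃ (P : OGraph.{u}) (p : OHom P G) (q : OHom P H), IsPullback p.hom q.hom f.hom g.hom := by
  have h := IsPullback.of_hasPullback f.hom g.hom
  have : Mono (pullback.snd f.hom g.hom) := h.mono_snd_of_mono
  exact ⟨⟨_, H.isOpen.of_mono (pullback.snd f.hom g.hom)⟩, ⟨_, .of_isPullback h.flip g.full⟩,
    ⟨_, .of_isPullback h f.full⟩, h⟩

theorem exists_isPushout (f : OHom X G) (g : OHom X H) (i : OHom G K) (j : OHom H K)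
    (w : f.hom ≫ i.hom = g.hom ≫ j.hom) [Mono (pushout.desc i.hom j.hom w)] :
    ∃ (M : OGraph.{u}) (i' : OHom G M) (j' : OHom H M) (k : OHom M K), Mono k.hom ∧
      i'.hom ≫ k.hom = i.hom ∧ j'.hom ≫ k.hom = j.hom ∧
      IsPushout f.hom g.hom i'.hom j'.hom := by
  have h := IsPushout.of_hasPushout f.hom g.hom
  have hi : pushout.inl f.hom g.hom ≫ pushout.desc i.hom j.hom w = i.hom := pushout.inl_desc ..
  have hj : pushout.inr f.hom g.hom ≫ pushout.desc i.hom j.hom w = j.hom := pushout.inr_desc ..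
  have hi_full : FullOnVertices (pushout.inl f.hom g.hom ≫ pushout.desc i.hom j.hom w) := by
    rw [hi]; exact i.full
  have hj_full : FullOnVertices (pushout.inr f.hom g.hom ≫ pushout.desc i.hom j.hom w) := by
    rw [hj]; exact j.full
  exact ⟨⟨_, K.isOpen.of_mono (pushout.desc i.hom j.hom w)⟩, ⟨_, .of_comp hi_full⟩,
    ⟨_, .of_comp hj_full⟩, ⟨_, .of_comp_of_isPushout h hi_full hj_full⟩, ‹_›, hi, hj, h⟩

end OHom

theorem isAdhesivePushout_iff_isPushout {A B C D : OGraph.{u}} {f : OHom A B} {g : OHom A C}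
    {i : OHom B D} {j : OHom C D} :
    IsAdhesivePushout f g i j ↔ IsPushout f.hom g.hom i.hom j.hom := by
  refine ⟨fun h => h.slice, fun h => ⟨fun X p q w => ?_, h⟩⟩
  have hp : i.hom ≫ h.desc p.hom q.hom w = p.hom := h.inl_desc ..
  have hq : j.hom ≫ h.desc p.hom q.hom w = q.hom := h.inr_desc ..
  have hfull : FullOnVertices (h.desc p.hom q.hom w) :=
    .of_comp_of_isPushout h (by rw [hp]; exact p.full) (by rw [hq]; exact q.full)
  refine ⟨⟨h.desc p.hom q.hom w, hfull⟩, ⟨hp, hq⟩, ?_⟩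
  exact fun v hv => OHom.ext (h.hom_ext (hv.1.trans hp.symm) (hv.2.trans hq.symm))

namespace OGraph

/-- The open-graph whose points form the type `P`, all of them isolated edge-points. -/
def points (P : Type u) : OGraph.{u} where
  typed := Over.mk (Y := parallelPair (X := PEmpty.{u + 1}) (Y := P)
      (TypeCat.ofHom PEmpty.elim) (TypeCat.ofHom PEmpty.elim))
    { app := fun
        | .zero => TypeCat.ofHom PEmpty.elim
        | .one => TypeCat.ofHom fun _ => TypePoint.eps
      naturality := by
        rintro _ _ (_ | _ | _)
        · ext x; exact x.elim
        · ext x; exact x.elim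
        · simp }
  isOpen := fun _ _ e => PEmpty.elim e

theorem isPointGraph_points (P : Type u) : (points P).IsPointGraph :=
  fun _ => ⟨⟨rfl, fun e => PEmpty.elim e⟩, ⟨rfl, fun e => PEmpty.elim e⟩⟩

/-- The morphism that selects a family of edge-points of `G`. -/
def pointsHom {P : Type u} (G : OGraph.{u}) (f : P → G.Point)
    (hf : ∀ x, IsEdgePoint G.typed (f x)) : OHom (points P) G where
  hom := Over.homMk
    { app := fun
        | .zero => TypeCat.ofHom PEmpty.elim
        | .one => TypeCat.ofHom f
      naturality := by
        rintro _ _ (_ | _ | _)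
        · ext x; exact x.elim
        · ext x; exact x.elim
        · simp }
    (by
      ext (_ | _) x
      · exact PEmpty.elim x
      · exact hf x)
  full := fun _ hv => by cases hv

theorem IsPointGraph.isEmpty_edge {B : OGraph.{u}} (hB : B.IsPointGraph) : IsEmpty B.Edge :=
  ⟨fun e => (hB (tgt B.typed e)).1.2 e rfl⟩

theorem IsPointGraph.mono_iff_injective_onPoint {B G : OGraph.{u}} (hB : B.IsPointGraph)
    {f : OHom B G} : Mono f.hom ↔ Function.Injective f.onPoint := by
  rw [mono_iff_injective_app]
  exact ⟨fun h => h .one, fun h => fun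
    | .zero => fun x => (hB.isEmpty_edge.false x).elim
    | .one => h⟩

end OGraph

theorem OHom.IsMono.injOn_isEdgePoint {G H : OGraph.{u}} {f : OHom G H} (hf : f.IsMono) :
    Set.InjOn f.onPoint {p | IsEdgePoint G.typed p} := by
  intro p hp q hq hpq
  have h := hf (.points PUnit) (G.pointsHom (fun _ => p) fun _ => hp)
    (G.pointsHom (fun _ => q) fun _ => hq) <| hom_ext_app fun
      | .zero => fun x => PEmpty.elim x
      | .one => fun _ => hpq
  exact congrArg (fun t : OHom (.points PUnit) G => t.onPoint PUnit.unit) h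

theorem OHom.IsMono.mono_of_isPointGraph {B G : OGraph.{u}} {f : OHom B G} (hf : f.IsMono)
    (hB : B.IsPointGraph) : Mono f.hom :=
  hB.mono_iff_injective_onPoint.2 fun x y hxy => hf.injOn_isEdgePoint (hB x).1.1 (hB y).1.1 hxy

section Boundary

variable {B G : OGraph.{u}} {b : OHom B G} {ins : Set B.Point}

/-- The summand of a boundary `B = Bⁱ ⊔ Bᵒ` that is mapped onto `free G φ`: the points in
`ins = Bⁱ` for `φ = right`, the others for `φ = left`. -/
def summand {α : Type*} (ins : Set α) :
    (WalkingParallelPair.zero ⟶ WalkingParallelPair.one) → Set α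
  | .left => insᶜ
  | .right => ins

theorem isBoundaryMap_iff : IsBoundaryMap b ins ↔
    B.IsPointGraph ∧ ∀ φ, Set.BijOn b.onPoint (summand ins φ) (free G.typed φ) :=
  ⟨fun h => ⟨h.pointGraph, fun
    | .left => h.bij_outputs
    | .right => h.bij_inputs⟩, fun h => ⟨h.1, h.2 .right, h.2 .left⟩⟩

theorem IsBoundaryMap.bijOn_free (h : IsBoundaryMap b ins)
    (φ : WalkingParallelPair.zero ⟶ WalkingParallelPair.one) :
    Set.BijOn b.onPoint (summand ins φ) (free G.typed φ) :=
  (isBoundaryMap_iff.1 h).2 φ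

theorem IsBoundaryMap.exists_onPoint_mem_free (h : IsBoundaryMap b ins) (x : B.Point) :
    ∃ φ, b.onPoint x ∈ free G.typed φ := by
  by_cases hx : x ∈ ins
  · exact ⟨.right, h.bij_inputs.mapsTo hx⟩
  · exact ⟨.left, h.bij_outputs.mapsTo hx⟩

theorem IsBoundaryMap.mono_iff_disjoint (h : IsBoundaryMap b ins) :
    Mono b.hom ↔ Disjoint G.inputs G.outputs := by
  rw [h.pointGraph.mono_iff_injective_onPoint, ← Set.injOn_univ, ← Set.union_compl_self ins,
    Set.injOn_union disjoint_compl_right, Set.disjoint_iff_forall_ne, ← h.bij_inputs.image_eq,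
    ← h.bij_outputs.image_eq]
  simp only [Set.forall_mem_image, h.bij_inputs.injOn, h.bij_outputs.injOn, true_and]

theorem bijOn_range_of_comp_eq_val {α β : Type*} {t : Set β} {ι : t → α} {f : α → β}
    (h : ∀ x, f (ι x) = x) : Set.BijOn f (Set.range ι) t := by
  refine ⟨?_, ?_, fun y hy => ⟨_, ⟨⟨y, hy⟩, rfl⟩, h _⟩⟩
  · rintro _ ⟨x, rfl⟩
    exact h x ▸ x.2
  · rintro _ ⟨x, rfl⟩ _ ⟨y, rfl⟩ hxy
    exact congrArg ι (Subtype.ext (by rwa [h, h] at hxy))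

theorem OGraph.exists_isBoundaryMap (G : OGraph.{u}) :
    ∃ (B : OGraph.{u}) (b : OHom B G) (ins : Set B.Point), IsBoundaryMap b ins := by
  have hcompl : (Set.range Sum.inl : Set (points (G.inputs ⊕ G.outputs)).Point)ᶜ =
      Set.range Sum.inr := Set.compl_range_inl
  refine ⟨.points (G.inputs ⊕ G.outputs),
    G.pointsHom (Sum.elim Subtype.val Subtype.val) (Sum.rec (fun x => x.2.1) fun x => x.2.1),
    Set.range Sum.inl, isPointGraph_points _, bijOn_range_of_comp_eq_val fun _ => rfl,
    hcompl ▸ bijOn_range_of_comp_eq_val fun _ => rfl⟩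

theorem disjoint_inputs_outputs_of_isPushout {A : TypedGraph.{u}} {C D : OGraph.{u}}
    {f : A ⟶ B.typed} {g : A ⟶ C.typed} {i : B.typed ⟶ D.typed} {j : C.typed ⟶ D.typed}
    (h : IsPushout f g i j) (hB : Disjoint B.inputs B.outputs)
    (hC : Disjoint C.inputs C.outputs) : Disjoint D.inputs D.outputs := by
  rw [Set.disjoint_left] at *
  intro p hp hp'
  obtain ⟨x, rfl⟩ | ⟨x, rfl⟩ := mem_range_or_mem_range_of_isPushout h p
  · exact hB (mem_free_of_onPoint_mem_free i hp) (mem_free_of_onPoint_mem_free i hp')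
  · exact hC (mem_free_of_onPoint_mem_free j hp) (mem_free_of_onPoint_mem_free j hp')

end Boundary

namespace TypedGraph

variable {B L D G : TypedGraph.{u}} {b : B ⟶ L} {c : B ⟶ D} {m : L ⟶ G} {s : D ⟶ G}
  {φ : WalkingParallelPair.zero ⟶ WalkingParallelPair.one} {I : Set (Point B)}

theorem free_subset_range_of_isPushout (h : IsPushout b c m s)
    (hI : Set.SurjOn (onPoint b) I (free L φ)) : free G φ ⊆ Set.range (onPoint s) := by
  intro p hp
  obtain ⟨l, rfl⟩ | hd := mem_range_or_mem_range_of_isPushout h p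
  · obtain ⟨x, -, rfl⟩ := hI (mem_free_of_onPoint_mem_free m hp)
    exact ⟨onPoint c x, (app_comm h.w x).symm⟩
  · exact hd

/- The right-hand side depends only on `c` and `I`, hence is the same for the two squares of a
double pushout. -/
theorem preimage_free_of_isPushout (h : IsPushout b c m s) [Mono b]
    (hI : Set.BijOn (onPoint b) I (free L φ)) :
    onPoint s ⁻¹' free G φ = {p ∈ free D φ | ∀ x, onPoint c x = p → x ∈ I} := by
  have hpb : IsPullback b c m s := Adhesive.isPullback_of_isPushout_of_mono_left h
  have : Mono s := Adhesive.mono_of_isPushout_of_mono_left h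
  ext p
  constructor
  · refine fun hp => ⟨mem_free_of_onPoint_mem_free s hp, ?_⟩
    rintro x rfl
    have hx : onPoint m (onPoint b x) ∈ free G φ :=
      Set.mem_of_eq_of_mem (app_comm h.w x) hp
    obtain ⟨y, hy, hyx⟩ := hI.surjOn (mem_free_of_onPoint_mem_free m hx)
    exact injective_app b _ hyx ▸ hy
  · rintro ⟨hp, hc⟩
    refine ⟨(isEdgePoint_onPoint_iff s).2 hp.1, fun e he => ?_⟩
    obtain ⟨e, rfl⟩ | ⟨e, rfl⟩ := mem_range_or_mem_range_of_isPushout h e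
    · obtain ⟨x, hx, hxp⟩ := exists_of_isPullback hpb ((onPoint_endpoint m e).trans he)
      exact (hI.mapsTo (hc x hxp)).2 e hx.symm
    · exact hp.2 e (injective_app s _ ((onPoint_endpoint s e).trans he))

end TypedGraph

section DoublePushout

variable {L B R G D G' : OGraph.{u}} {r : RewriteRule L B R} {m : OHom L G} {c : OHom B D}
  {s : OHom D G} {n : OHom R G'} {s' : OHom D G'}

instance RewriteRule.mono_left (r : RewriteRule L B R) : Mono r.left.hom :=
  r.isRule.1.mono_of_isPointGraph r.isBoundary_left.pointGraph

instance RewriteRule.mono_right (r : RewriteRule L B R) : Mono r.right.hom :=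
  r.isRule.2.mono_of_isPointGraph r.isBoundary_right.pointGraph

/-- The double pushout by which `r` rewrites `G` to `G'` at `m`, with the context `D`: its squares
are pushouts of typed graphs along the monomorphism `c`. -/
structure IsDoublePushout (r : RewriteRule L B R) (m : OHom L G) (c : OHom B D) (s : OHom D G)
    (n : OHom R G') (s' : OHom D G') : Prop where
  mono_context : Mono c.hom
  left : IsPushout r.left.hom c.hom m.hom s.hom
  right : IsPushout r.right.hom c.hom n.hom s'.hom

namespace IsDoublePushout

variable (h : IsDoublePushout r m c s n s')

include h

theorem op : IsDoublePushout r.op n c s' m s := ⟨h.mono_context, h.right, h.left⟩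

theorem mono_matching : Mono m.hom :=
  have := h.mono_context
  Adhesive.mono_of_isPushout_of_mono_right h.left

theorem mono_left : Mono s.hom := Adhesive.mono_of_isPushout_of_mono_left h.left

theorem isBoundaryMap {B' : OGraph.{u}} {k : OHom B' D} {b : OHom B' G} {b' : OHom B' G'}
    {ins : Set B'.Point} (hb : IsBoundaryMap b ins) (hk : k.hom ≫ s.hom = b.hom)
    (hk' : k.hom ≫ s'.hom = b'.hom) : IsBoundaryMap b' ins := by
  have := h.mono_left
  have := h.op.mono_left
  refine isBoundaryMap_iff.2 ⟨hb.pointGraph, fun φ => ?_⟩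
  have hL := r.isBoundary_left.bijOn_free φ
  have hR := r.isBoundary_right.bijOn_free φ
  have hbij : Set.BijOn (onPoint (k.hom ≫ s.hom)) (summand ins φ) (free G.typed φ) :=
    hk ▸ hb.bijOn_free φ
  suffices Set.BijOn (onPoint (k.hom ≫ s'.hom)) (summand ins φ) (free G'.typed φ) by
    rwa [hk'] at this
  refine (bijOn_comp_iff_of_injective (injective_app s'.hom _)
    (free_subset_range_of_isPushout h.right hR.surjOn)).2 ?_
  rw [preimage_free_of_isPushout h.right hR, ← preimage_free_of_isPushout h.left hL]
  exact (bijOn_comp_iff_of_injective (injective_app s.hom _)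
    (free_subset_range_of_isPushout h.left hL.surjOn)).1 hbij

theorem exists_isExtension {B' : OGraph.{u}} {b : OHom B' G} {ins : Set B'.Point}
    (hb : IsBoundaryMap b ins) : ∃ (e : BoundarySpan G B' G') (k : OHom B' D),
      e.left = b ∧ e.ins = ins ∧ k.hom ≫ s.hom = b.hom ∧ k.hom ≫ s'.hom = e.right.hom ∧
      IsExtension r m e := by
  have := h.mono_left
  have := h.op.mono_left
  have := h.mono_matching
  obtain ⟨k, hk⟩ := b.exists_lift s fun
    | .zero => fun x => (hb.pointGraph.isEmpty_edge.false x).elim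
    | .one => fun x =>
      have ⟨φ, hφ⟩ := hb.exists_onPoint_mem_free x
      free_subset_range_of_isPushout h.left (r.isBoundary_left.bijOn_free φ).surjOn hφ
  let b' : OHom B' G' := ⟨k.hom ≫ s'.hom, k.full.comp s'.full⟩
  exact ⟨⟨b, b', ins, hb, h.isBoundaryMap hb hk rfl⟩, k, rfl, rfl, hk, rfl, m.isMono_of_mono,
    D, c, s, n, s', isAdhesivePushout_iff_isPushout.2 h.left,
    isAdhesivePushout_iff_isPushout.2 h.right, k, hk, rfl⟩

end IsDoublePushout

theorem IsExtension.exists_isDoublePushout {B' : OGraph.{u}} {e : BoundarySpan G B' G'}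
    (h : IsExtension r m e) : ∃ (D : OGraph.{u}) (c : OHom B D) (s : OHom D G) (n : OHom R G')
      (s' : OHom D G'), IsDoublePushout r m c s n s' := by
  obtain ⟨hm, D, c, s, n, s', hl, hr, -⟩ := h
  refine ⟨D, c, s, n, s', ?_, hl.slice, hr.slice⟩
  rw [r.isBoundary_left.pointGraph.mono_iff_injective_onPoint]
  intro x y hxy
  have hB := r.isBoundary_left.pointGraph
  have hxy' : m.onPoint (r.left.onPoint x) = m.onPoint (r.left.onPoint y) :=
    (app_comm hl.slice.w x).trans ((congrArg s.onPoint hxy).trans (app_comm hl.slice.w y).symm)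
  exact injective_app r.left.hom _ <| hm.injOn_isEdgePoint
    ((isEdgePoint_onPoint_iff r.left.hom).2 (hB x).1.1)
    ((isEdgePoint_onPoint_iff r.left.hom).2 (hB y).1.1) hxy'

end DoublePushout

section Complement

variable {B M G : OGraph.{u}} {b : OHom B M} {ins : Set B.Point}

/-- The part of `G` outside the subgraph `M`, together with the boundary of `M`. -/
def IsBoundaryMap.complement (hb : IsBoundaryMap b ins) (j : OHom M G) :
    Subfunctor G.typed.left where
  obj Z := {y | y ∈ Set.range (j.hom.left.app Z) → y ∈ Set.range ((b.hom ≫ j.hom).left.app Z)}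
  map := by
    have key (φ : WalkingParallelPair.zero ⟶ WalkingParallelPair.one) (e : G.Edge)
        (he : e ∈ Set.range (onEdge j.hom) → e ∈ Set.range (onEdge (b.hom ≫ j.hom)))
        (hp : endpoint G.typed φ e ∈ Set.range (onPoint j.hom)) :
        endpoint G.typed φ e ∈ Set.range (onPoint (b.hom ≫ j.hom)) := by
      obtain ⟨p, hp⟩ := hp
      have he' : e ∉ Set.range (onEdge j.hom) := fun hj =>
        have ⟨x, _⟩ := he hj
        hb.pointGraph.isEmpty_edge.false x
      obtain ⟨x, -, rfl⟩ := (hb.bijOn_free φ).surjOn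
        (mem_free_of_endpoint_eq_onPoint G.isOpen j.full hp.symm he')
      exact ⟨x, hp⟩
    rintro _ _ (_ | _ | _) y hy
    · exact key .left y hy
    · exact key .right y hy
    · simpa using hy

theorem IsBoundaryMap.fullOnVertices_complement_ι (hb : IsBoundaryMap b ins) (j : OHom M G) :
    FullOnVertices (Over.homMk (hb.complement j).ι :
      Over.mk ((hb.complement j).ι ≫ G.typed.hom) ⟶ G.typed) := by
  rw [fullOnVertices_iff]
  rintro φ ⟨v, hv⟩ hvertex e rfl
  refine ⟨⟨e, fun he => ?_⟩, rfl⟩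
  obtain ⟨e, rfl⟩ := he
  obtain ⟨x, hx⟩ := hv ⟨endpoint M.typed φ e, onPoint_endpoint j.hom e⟩
  have hxv : IsVertex G.typed (onPoint (b.hom ≫ j.hom) x) :=
    (congrArg (IsVertex G.typed) hx).mpr hvertex
  rw [isVertex_onPoint_iff] at hxv
  exact ((hb.pointGraph x).1.1.not_isVertex hxv).elim

theorem IsBoundaryMap.exists_isPushout_complement (hb : IsBoundaryMap b ins) [Mono b.hom]
    (j : OHom M G) [Mono j.hom] :
    ∃ (D : OGraph.{u}) (c : OHom B D) (d : OHom D G),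
      Mono c.hom ∧ IsPushout b.hom c.hom j.hom d.hom := by
  let S := hb.complement j
  let d : Over.mk (S.ι ≫ G.typed.hom) ⟶ G.typed := Over.homMk S.ι
  have : Mono d := mono_iff_injective_app.2 fun Z => Subtype.val_injective
  let D : OGraph.{u} := ⟨_, G.isOpen.of_mono d⟩
  let d' : OHom D G := ⟨d, hb.fullOnVertices_complement_ι j⟩
  have : Mono d'.hom := ‹Mono d›
  obtain ⟨c, hc⟩ := OHom.exists_lift ⟨b.hom ≫ j.hom, b.full.comp j.full⟩ d' fun Z x =>
    ⟨⟨_, fun _ => ⟨x, rfl⟩⟩, rfl⟩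
  have : Mono (c.hom ≫ d'.hom) := hc ▸ mono_comp b.hom j.hom
  refine ⟨D, c, d', mono_of_mono c.hom d'.hom, isPushout_of_isPullback_of_cover
    (isPullback_of_forall_mem_range hc.symm ?_) fun Z z => ?_⟩
  · rintro Z x ⟨⟨y, hy⟩, rfl : y = _⟩
    obtain ⟨a, ha⟩ := hy ⟨x, rfl⟩
    exact ⟨a, injective_app j.hom Z ha⟩
  · by_cases hz : z ∈ Set.range (j.hom.left.app Z)
    · exact Or.inl hz
    · exact Or.inr ⟨⟨z, fun h => (hz h).elim⟩, rfl⟩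

end Complement

section Merging

variable {A B C D : OGraph.{u}} {f : OHom A B} {g : OHom A C} {i : OHom B D} {j : OHom C D}

theorem onPoint_mem_free_or_of_isPullback (h : IsPullback f.hom g.hom i.hom j.hom) [Mono f.hom]
    {φ : WalkingParallelPair.zero ⟶ WalkingParallelPair.one} {p : A.Point}
    (hp : p ∈ free A.typed φ) :
    f.onPoint p ∈ free B.typed φ ∨ g.onPoint p ∈ free C.typed φ := by
  by_contra! hfree
  have hf : IsEdgePoint B.typed (f.onPoint p) := (isEdgePoint_onPoint_iff f.hom).2 hp.1
  have hg : IsEdgePoint C.typed (g.onPoint p) := (isEdgePoint_onPoint_iff g.hom).2 hp.1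
  have ⟨e, he⟩ : ∃ e, endpoint B.typed φ e = f.onPoint p := by
    by_contra! hne
    exact hfree.1 ⟨hf, hne⟩
  have ⟨e', he'⟩ : ∃ e, endpoint C.typed φ e = g.onPoint p := by
    by_contra! hne
    exact hfree.2 ⟨hg, hne⟩
  have hee' : onEdge i.hom e = onEdge j.hom e' := by
    refine isOpen_iff.1 D.isOpen φ _ _ ?_ ?_
    · rwa [← onPoint_endpoint, he', isEdgePoint_onPoint_iff]
    · rw [← onPoint_endpoint, ← onPoint_endpoint, he, he']
      exact app_comm h.w p
  obtain ⟨a, rfl, -⟩ := exists_of_isPullback h hee'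
  exact hp.2 a (injective_app f.hom _ ((onPoint_endpoint f.hom a).trans he))

theorem isBoundaryCoherent_of_isPullback (h : IsPullback f.hom g.hom i.hom j.hom) [Mono f.hom]
    [Mono g.hom] : IsBoundaryCoherent f g :=
  ⟨f.isMono_of_mono, g.isMono_of_mono, fun _ hp => onPoint_mem_free_or_of_isPullback h hp,
    fun _ hp => onPoint_mem_free_or_of_isPullback h hp⟩

theorem exists_isMerging (i : OHom B D) (j : OHom C D) [Mono i.hom] [Mono j.hom] :
    ∃ (K : OGraph.{u}) (k₁ : OHom K B) (k₂ : OHom K C) (M : OGraph.{u}) (i' : OHom B M)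
      (j' : OHom C M) (k : OHom M D), IsMerging k₁ k₂ i' j' ∧ Mono k.hom ∧
      i'.hom ≫ k.hom = i.hom ∧ j'.hom ≫ k.hom = j.hom := by
  obtain ⟨K, k₁, k₂, h⟩ := i.exists_isPullback j
  have := h.mono_fst_of_mono
  have := h.mono_snd_of_mono
  have : Mono (pushout.desc i.hom j.hom h.w) := mono_of_isPullback_of_isPushout h
    (.of_hasPushout ..) (pushout.inl_desc ..) (pushout.inr_desc ..)
  obtain ⟨M, i', j', k, hk, hi, hj, hM⟩ := k₁.exists_isPushout k₂ i j h.w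
  exact ⟨K, k₁, k₂, M, i', j', k, ⟨isBoundaryCoherent_of_isPullback h,
    isAdhesivePushout_iff_isPushout.2 hM⟩, hk, hi, hj⟩

end Merging

section Restriction

variable {L B R G D G' : OGraph.{u}} {r : RewriteRule L B R} {m : OHom L G} {c : OHom B D}
  {s : OHom D G} {n : OHom R G'} {s' : OHom D G'}

theorem IsExtension.mono_right {B' : OGraph.{u}} {e : BoundarySpan G B' G'}
    (h : IsExtension r m e) [Mono e.left.hom] : Mono e.right.hom := by
  obtain ⟨-, D, c, s, n, s', -, hr, k, hk, hk'⟩ := h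
  have : Mono s'.hom := Adhesive.mono_of_isPushout_of_mono_left hr.slice
  have : Mono (k.hom ≫ s.hom) := hk ▸ inferInstance
  have : Mono k.hom := mono_of_mono k.hom s.hom
  exact hk' ▸ mono_comp k.hom s'.hom

theorem IsExtension.isRule {B' : OGraph.{u}} {e : BoundarySpan G B' G'} (h : IsExtension r m e)
    (hleft : e.left.IsMono) : e.IsRule :=
  have := hleft.mono_of_isPointGraph e.isBoundary_left.pointGraph
  have := h.mono_right
  ⟨hleft, e.right.isMono_of_mono⟩

variable {M : OGraph.{u}} {i : OHom L M} {j : OHom M G} [Mono j.hom]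

theorem IsDoublePushout.exists_restriction (h : IsDoublePushout r m c s n s')
    (hij : i.hom ≫ j.hom = m.hom) : ∃ (D₀ H : OGraph.{u}) (c₀ : OHom B D₀) (s₀ : OHom D₀ M)
      (n₀ : OHom R H) (s₀' : OHom D₀ H) (a : OHom D₀ D) (g : OHom H G'),
      IsDoublePushout r i c₀ s₀ n₀ s₀' ∧ IsPullback s₀.hom a.hom j.hom s.hom ∧
      IsPushout s₀'.hom a.hom g.hom s'.hom := by
  have := h.mono_context
  have := h.op.mono_left
  obtain ⟨D₀, s₀, a, hpb⟩ := j.exists_isPullback s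
  have : Mono a.hom := hpb.mono_snd_of_mono
  have hw : (r.left.hom ≫ i.hom) ≫ j.hom = c.hom ≫ s.hom := by
    rw [Category.assoc, hij, h.left.w]
  have hc : hpb.lift (r.left.hom ≫ i.hom) c.hom hw ≫ a.hom = c.hom := hpb.lift_snd ..
  let c₀ : OHom B D₀ := ⟨hpb.lift _ c.hom hw, .of_comp (g := a.hom) (by rw [hc]; exact c.full)⟩
  have : Mono (c₀.hom ≫ a.hom) := hc ▸ ‹Mono c.hom›
  have : Mono c₀.hom := mono_of_mono c₀.hom a.hom
  have hright : IsPushout r.right.hom (c₀.hom ≫ a.hom) n.hom s'.hom := hc ▸ h.right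
  let sa : OHom D₀ G' := ⟨a.hom ≫ s'.hom, a.full.comp s'.full⟩
  have hw' : r.right.hom ≫ n.hom = c₀.hom ≫ sa.hom := by simp [sa, hright.w]
  have : Mono (pushout.desc n.hom sa.hom hw') :=
    Adhesive.mono_of_isPushout_of_mono_right <|
    .of_top (by rwa [pushout.inl_desc]) (pushout.inr_desc ..) (.of_hasPushout ..)
  obtain ⟨H, n₀, s₀', g, -, hn, hs, hH⟩ := r.right.exists_isPushout c₀ n sa hw'
  exact ⟨D₀, H, c₀, s₀, n₀, s₀', a, g,
    ⟨‹_›, isPushout_of_isPullback_of_mono h.left hij hpb hc, hH⟩, hpb,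
    .of_top (hn ▸ hright) hs hH⟩

theorem IsDoublePushout.exists_isExtension_isPushout (h : IsDoublePushout r m c s n s')
    (hij : i.hom ≫ j.hom = m.hom) {A E : OGraph.{u}} {b : OHom A M} {ins : Set A.Point}
    (hb : IsBoundaryMap b ins) {c' : OHom A E} {d : OHom E G} [Mono c'.hom]
    (hE : IsPushout b.hom c'.hom j.hom d.hom) :
    ∃ (H : OGraph.{u}) (e : BoundarySpan M A H) (g : OHom H G') (d' : OHom E G'),
      e.left = b ∧ e.ins = ins ∧ IsExtension r i e ∧
      IsPushout e.right.hom c'.hom g.hom d'.hom := by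
  obtain ⟨D₀, H, c₀, s₀, n₀, s₀', a, g, h₀, hpb, hg⟩ := h.exists_restriction hij
  obtain ⟨e, k, hleft, hins, hk, hk', he⟩ := h₀.exists_isExtension hb
  have := h.mono_left
  have := h.op.mono_left
  have hEpb : IsPullback c'.hom b.hom d.hom j.hom :=
    Adhesive.isPullback_of_isPushout_of_mono_left hE.flip
  obtain ⟨v, hv⟩ := d.exists_lift s fun Z z => by
    obtain ⟨l, hl⟩ | hs := mem_range_or_mem_range_of_isPushout h.left (d.hom.left.app Z z)
    · rw [← hij] at hl
      obtain ⟨x, rfl, -⟩ := exists_of_isPullback hEpb hl.symm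
      rw [← app_comm hE.w, ← hk]
      exact ⟨a.hom.left.app Z (k.hom.left.app Z x), (app_comm hpb.w _).symm⟩
    · exact hs
  have hv' : IsPushout c'.hom k.hom v.hom a.hom :=
    isPushout_of_isPullback_of_mono hE.flip hv hpb.flip hk
  exact ⟨H, e, g, ⟨v.hom ≫ s'.hom, v.full.comp s'.full⟩, hleft, hins, he,
    hk' ▸ hv'.flip.paste_horiz hg⟩

end Restriction

section Composition

variable {L₁ B₁ R₁ L₂ B₂ R₂ K M B G G' : OGraph.{u}} {r₁ : RewriteRule L₁ B₁ R₁}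
  {r₂ : RewriteRule L₂ B₂ R₂} {k₁ : OHom K R₁} {k₂ : OHom K L₂} {i₁ : OHom R₁ M} {i₂ : OHom L₂ M}

theorem IsMerging.mono_of_isBoundaryMap (hM : IsMerging k₁ k₂ i₁ i₂) (r₁ : RewriteRule L₁ B₁ R₁)
    (r₂ : RewriteRule L₂ B₂ R₂) {b : OHom B M} {ins : Set B.Point} (hb : IsBoundaryMap b ins) :
    Mono b.hom :=
  hb.mono_iff_disjoint.2 <| disjoint_inputs_outputs_of_isPushout hM.2.slice
    (r₁.isBoundary_right.mono_iff_disjoint.1 inferInstance)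
    (r₂.isBoundary_left.mono_iff_disjoint.1 inferInstance)

theorem IsMerging.exists_isSeqComp (hM : IsMerging k₁ k₂ i₁ i₂) {f₁ : BoundarySpan M B G}
    {f₂ : BoundarySpan M B G'} (h₁ : IsExtension r₁.op i₁ f₁) (h₂ : IsExtension r₂ i₂ f₂)
    (hleft : f₁.left = f₂.left) (hins : f₁.ins = f₂.ins) :
    ∃ q : RewriteRule G B G', q.left = f₁.right ∧ q.right = f₂.right ∧
      IsSeqComp r₁ r₂ k₁ k₂ q := by
  have : Mono f₁.left.hom := hM.mono_of_isBoundaryMap r₁ r₂ f₁.isBoundary_left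
  have : Mono f₂.left.hom := hleft ▸ this
  have := h₁.mono_right
  have := h₂.mono_right
  let q : RewriteRule G B G' :=
    { left := f₁.right
      right := f₂.right
      ins := f₁.ins
      isBoundary_left := f₁.isBoundary_right
      isBoundary_right := hins ▸ f₂.isBoundary_right
      isRule := ⟨f₁.right.isMono_of_mono, f₂.right.isMono_of_mono⟩ }
  exact ⟨q, rfl, rfl, M, i₁, i₂, f₁, f₂, hM, h₁, h₂, hleft, hins, rfl, rfl, rfl⟩

end Composition

end OpenGraph

theorem mainTheorem9
    {L₁ B₁ R₁ L₂ B₂ R₂ M₁ M₂ M₃ C₁ C₂ : OpenGraph.OGraph.{u}}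
    (r₁ : OpenGraph.RewriteRule L₁ B₁ R₁) (r₂ : OpenGraph.RewriteRule L₂ B₂ R₂)
    (m₁ : OpenGraph.OHom L₁ M₁) (m₂ : OpenGraph.OHom L₂ M₂)
    (e₁ : OpenGraph.BoundarySpan M₁ C₁ M₂) (e₂ : OpenGraph.BoundarySpan M₂ C₂ M₃)
    (h₁ : OpenGraph.IsExtension r₁ m₁ e₁) (h₂ : OpenGraph.IsExtension r₂ m₂ e₂) :
    ∃ (K : OpenGraph.OGraph.{u}) (k₁ : OpenGraph.OHom K R₁) (k₂ : OpenGraph.OHom K L₂)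
      (G B G' : OpenGraph.OGraph.{u}) (q : OpenGraph.RewriteRule G B G')
      (m' : OpenGraph.OHom G M₁)
      (C : OpenGraph.OGraph.{u}) (e : OpenGraph.BoundarySpan M₁ C M₃),
      OpenGraph.IsSeqComp r₁ r₂ k₁ k₂ q ∧
      OpenGraph.IsExtension q m' e ∧
      (e₁.IsRule → e₂.IsRule → e.IsRule) := by
  obtain ⟨D₁, c₁, s₁, n₁, t₁, h₁'⟩ := h₁.exists_isDoublePushout
  obtain ⟨D₂, c₂, s₂, n₂, t₂, h₂'⟩ := h₂.exists_isDoublePushout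
  have : Mono n₁.hom := h₁'.op.mono_matching
  have : Mono m₂.hom := h₂'.mono_matching
  obtain ⟨K, k₁, k₂, M, i₁, i₂, j, hM, _, hj₁, hj₂⟩ := OpenGraph.exists_isMerging n₁ m₂
  obtain ⟨B, b, ins, hb⟩ := M.exists_isBoundaryMap
  have : Mono b.hom := hM.mono_of_isBoundaryMap r₁ r₂ hb
  obtain ⟨E, c, d, _, hE⟩ := hb.exists_isPushout_complement j
  obtain ⟨G, f₁, g₁, d₁, hb₁, hins₁, hf₁, hG⟩ := h₁'.op.exists_isExtension_isPushout hj₁ hb hE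
  obtain ⟨G', f₂, g₂, d₂, hb₂, hins₂, hf₂, hG'⟩ := h₂'.exists_isExtension_isPushout hj₂ hb hE
  obtain ⟨q, hleft, hright, hq⟩ :=
    hM.exists_isSeqComp hf₁ hf₂ (hb₁.trans hb₂.symm) (hins₁.trans hins₂.symm)
  have h : OpenGraph.IsDoublePushout q g₁ c d₁ g₂ d₂ := ⟨‹_›, hleft ▸ hG, hright ▸ hG'⟩
  obtain ⟨e, -, he, -, -, -, hext⟩ := h.exists_isExtension e₁.isBoundary_left
  exact ⟨K, k₁, k₂, G, B, G', q, g₁, C₁, e, hq, hext, fun hr₁ _ => hext.isRule (he ▸ hr₁.1)⟩
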